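/- There exist absolute constants $\beta>0$ and $U\in(0,1)$ such that the following holds for all positive integers $q,d$ satisfying $q\ge 1.59d+\beta$. For a finite graph $G=(V,E)$, let $\mu_G$ be the uniform distribution on the set $\Omega_G$ of proper $q$-colorings $\sigma:V\to[q]$ of $G$. An assignment $\eta:\Lambda\to[q]$ with $\Lambda\subseteq V$ is extendible if it is the restriction $\sigma_\Lambda$ to $\Lambda$ of some $\sigma\in\Omega_G$; in that case, for $v\in V$, let $\boldsymbol{\pi}_{G,v,\eta}\in\mathbb{R}^q$ be the vector with entries $\mu_G(\sigma_v=c\mid\sigma_\Lambda=\eta)$, $c\in[q]$. Let $T$ be the $d$-ary tree of height $h\ge 1$ rooted at $\rho$ (every vertex at depth less than $h$ has exactly $d$ children), let $\Lambda$ be a subset of the vertices of $T$, and let $\eta,\eta':\Lambda\to[q]$ be two extendible assignments of $T$ with $\mathrm{dist}(\rho,\Delta)\ge 3$, where $\Delta\subseteq\Lambda$ is the set of vertices where $\eta$ and $\eta'$ disagree (and $\mathrm{dist}(\rho,\emptyset)=\infty$). Let $v_1,\dots,v_d$ be the children of $\rho$ and, for $i\in[d]$, let $T_i=(V_i,E_i)$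 be the subtree of $T$ rooted at $v_i$ that consists of $v_i$ and all its descendants in $T$. Then $$\big\|\boldsymbol{\pi}-\boldsymbol{\pi}'\big\|_2^2\le U\max_{i\in[d]}\big\|\boldsymbol{\pi}_i-\boldsymbol{\pi}_i'\big\|_2^2,$$ where $\boldsymbol{\pi}=\boldsymbol{\pi}_{T,\rho,\eta}$, $\boldsymbol{\pi}'=\boldsymbol{\pi}_{T,\rho,\eta'}$ and, for $i\in[d]$, $\boldsymbol{\pi}_i=\boldsymbol{\pi}_{T_i,v_i,\eta(\Lambda\cap V_i)}$, $\boldsymbol{\pi}_i'=\boldsymbol{\pi}_{T_i,v_i,\eta'(\Lambda\cap V_i)}$, with $\eta(\Lambda\cap V_i)$ and $\eta'(\Lambda\cap V_i)$ the restrictions of $\eta$ and $\eta'$ to $\Lambda\cap V_i$. -/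

import Mathlib

noncomputable section

/-- `Ω_G`: the set of proper `q`-colorings of the graph `G`. -/
def properColorings {V : Type*} (G : SimpleGraph V) (q : ℕ) : Set (V → Fin q) :=
  {σ | ∀ u v, G.Adj u v → σ u ≠ σ v}

/-- `μ_G`: the uniform probability distribution on the proper `q`-colorings of the (finite)
graph `G`. -/
def colorMeasure {V : Type*} (G : SimpleGraph V) (q : ℕ) : MeasureTheory.Measure (V → Fin q) :=
  ProbabilityTheory.uniformOn (properColorings G q)

/-- The event `σ_Λ = η`. -/
def agreeEvent {V : Type*} {q : ℕ} {Λ : Set V} (η : Λ → Fin q) : Set (V → Fin q) :=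
  {σ | Set.domRestrict Λ σ = η}

/-- An assignment `η : Λ → [q]` is extendible if some proper coloring restricts to it. -/
def Extendible {V : Type*} (G : SimpleGraph V) {q : ℕ} {Λ : Set V} (η : Λ → Fin q) : Prop :=
  ∃ σ ∈ properColorings G q, σ ∈ agreeEvent η

/-- `π_{G,v,η}`: the vector whose `c`-th entry is `μ_G(σ_v = c ∣ σ_Λ = η)`, as an element of
`ℝ^q` with the `L²` norm. -/
def marginal {V : Type*} (G : SimpleGraph V) {q : ℕ} (v : V) {Λ : Set V} (η : Λ → Fin q) :
    EuclideanSpace ℝ (Fin q) :=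
  WithLp.toLp 2 fun c =>
    (ProbabilityTheory.cond (colorMeasure G q) (agreeEvent η) {σ | σ v = c}).toReal

/-- On a finite graph, the marginal of an extendible assignment is a ratio of numbers of proper
colorings. -/
theorem marginal_apply {V : Type*} [Finite V] (G : SimpleGraph V) {q : ℕ} (v : V) {Λ : Set V}
    (η : Λ → Fin q) (c : Fin q) :
    marginal G v η c =
      ((properColorings G q ∩ agreeEvent η ∩ {σ | σ v = c}).ncard : ℝ) /
        ((properColorings G q ∩ agreeEvent η).ncard : ℝ) := by
  classical
  have hm : ∀ s : Set (V → Fin q), MeasurableSet s := fun s => s.toFinite.measurableSet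
  have hc : ∀ s : Set (V → Fin q), MeasureTheory.Measure.count s = (s.ncard : ENNReal) := by
    intro s
    rw [MeasureTheory.Measure.count_apply (hm s), ← Set.Finite.cast_ncard_eq s.toFinite]
    rfl
  simp only [marginal, colorMeasure, ProbabilityTheory.uniformOn]
  rw [ProbabilityTheory.cond_cond_eq_cond_inter' (hm _) (hm _) (by rw [hc]; simp),
    ProbabilityTheory.cond_apply (hm _), hc, hc]
  simp [div_eq_inv_mul]

/-- The set `Δ` of vertices where two assignments on `Λ` disagree. -/
def disagreement {V : Type*} {q : ℕ} {Λ : Set V} (η η' : Λ → Fin q) : Set V :=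
  {u | ∃ hu : u ∈ Λ, η ⟨u, hu⟩ ≠ η' ⟨u, hu⟩}

/-- The graph distance from a vertex to a set of vertices (`⊤` if the set is empty). -/
def distToSet {V : Type*} (G : SimpleGraph V) (v : V) (S : Set V) : ℕ∞ :=
  ⨅ u ∈ S, G.edist v u

/-- The restriction `η(Λ ∩ W)` of an assignment to the vertices in `W`, as an assignment for an
induced subgraph on `W`. -/
def restrictAssignment {V : Type*} {q : ℕ} {Λ : Set V} (W : Set V) (η : Λ → Fin q) :
    ((Subtype.val : W → V) ⁻¹' Λ : Set W) → Fin q :=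
  fun u => η ⟨u.1.1, u.2⟩

/-- The vertices of the `d`-ary tree of height `h`: a vertex is the word over `[d]`, of length at
most `h`, that lists the branches taken on the way from the root to it. -/
abbrev TreeVertex (d h : ℕ) : Type := {w : List (Fin d) // w.length ≤ h}

instance (d h : ℕ) : Finite (TreeVertex d h) := List.finite_length_le (Fin d) h

/-- The `d`-ary tree of height `h`: every vertex `w` of depth less than `h` is joined to its `d`
children `w ++ [i]`. -/
def daryTree (d h : ℕ) : SimpleGraph (TreeVertex d h) :=
  SimpleGraph.fromRel fun u v => ∃ i : Fin d, v.1 = u.1 ++ [i]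

/-- The root `ρ`. -/
def treeRoot (d h : ℕ) : TreeVertex d h := ⟨[], Nat.zero_le h⟩

/-- The `i`-th child `v_i` of the root, in a tree of height at least one. -/
def rootChild {d h : ℕ} (hh : 1 ≤ h) (i : Fin d) : TreeVertex d h := ⟨[i], hh⟩

/-- The set of the descendants of `v` (with `v` itself). -/
def descendants {d h : ℕ} (v : TreeVertex d h) : Set (TreeVertex d h) :=
  {w | v.1 <+: w.1}

theorem self_mem_descendants {d h : ℕ} (v : TreeVertex d h) : v ∈ descendants v :=
  List.prefix_refl v.1

/-- The marginal `π_{T_i, v_i, η(Λ ∩ V_i)}`, where `T_i` is the subtree of `T` induced by the set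
`V_i` of the descendants of the `i`-th child `v_i` of the root. -/
def childMarginal {d h q : ℕ} (hh : 1 ≤ h) {Λ : Set (TreeVertex d h)} (η : Λ → Fin q)
    (i : Fin d) : EuclideanSpace ℝ (Fin q) :=
  marginal ((daryTree d h).induce (descendants (rootChild hh i)))
    ⟨rootChild hh i, self_mem_descendants _⟩
    (restrictAssignment (descendants (rootChild hh i)) η)

end

/-!
Put `x_i = π_i`. If the root is pinned, both marginals are the same point mass; otherwise `π` is
the image of `(x_1, …, x_d)` under belief propagation, `π(c) ∝ ∏ᵢ (1 - x_i(c))`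
(`rootMarginal_succ`). As `η` and `η'` agree up to depth two, the pinned children carry equal
point masses, and for each free child `i` the set `A_i` of colors pinned on its own children is
the same for `η` and `η'`. So both marginals of a free child vanish on `A_i`, are at most
`θ = 1 / (q - d)` everywhere (`rootMarginal_le`), and are at least `L = 0.2632 / q` off `A_i`
(`beliefPropagation_ge`).

These three properties are convex, so they persist on the segment from `x'` to `x`. Along it, belief
propagation is a softmax `F` of `∑ᵢ log (1 - x_i(c))`, with derivative
`F_c (w_c - ∑ F w)`, `w_c = -∑ᵢ v_i(c) / (1 - x_i(c))` for the direction `v = x - x'` of the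
segment, where only the `n_c` free children with `c ∉ A_i` contribute to `w_c`. Cauchy–Schwarz bounds `w_c ^ 2` by `n_c` times a sum of squares,
and what remains is a bound for the norm of `√n (diag F - F Fᵀ)`. Estimating it by
`max √(n_c F_c) · max √F_c` is too lossy. Instead `weighted_variance_le` gives the bound
`max (D + n_c) F_c / (2 √D)`, `D` being the number of free children, in which a color has a large
`F_c` only if `n_c` is small: indeed `F_c ≤ exp (D / (Q (1 - θ)) - n_c L) / Q` for `Q` available
colors (`softmax_logWeight_le`). The result is a contraction by about `a e ^ (a (1 - ℓ))` with
`a = d / q ≤ 1 / 1.59` and `ℓ = 0.2632`, which is just below `1` (`contraction_factor_le`).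
Requiring `q ≥ 1.59 d + 10 ^ 6` makes `θ` small enough for the error terms of order `θ`.
-/

section

open Finset

/-! ### A variance inequality and the softmax map -/

noncomputable section

/-- A bound `max (D + n_c) F_c / (2 √D)` for the norm of `√n (diag F - F Fᵀ)`, where `F` is a
probability vector. After adding a multiple of the identity
`∑ F ((t - τ) ^ 2 - t ^ 2 + τ ^ 2) = 0`, the difference of the two sides is termwise at least
`((D F_c - K) t_c - D F_c τ) ^ 2`. -/
theorem weighted_variance_le {κ : Type*} (G : Finset κ) (F n t : κ → ℝ) {D K : ℝ} (hD : 0 ≤ D)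
    (hF : ∀ c ∈ G, 0 ≤ F c) (hsum : ∑ c ∈ G, F c = 1)
    (hK : ∀ c ∈ G, (D + n c) * F c ≤ 2 * K) :
    D * ∑ c ∈ G, n c * (F c * (t c - ∑ c' ∈ G, F c' * t c')) ^ 2 ≤ K ^ 2 * ∑ c ∈ G, t c ^ 2 := by
  set τ := ∑ c' ∈ G, F c' * t c' with hτ
  have hvar : ∑ c ∈ G, D * K * (F c * ((t c - τ) ^ 2 - t c ^ 2 + τ ^ 2)) = 0 := by
    have h1 : ∑ c ∈ G, D * K * (F c * ((t c - τ) ^ 2 - t c ^ 2 + τ ^ 2)) =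
        D * K * (2 * τ ^ 2 * ∑ c ∈ G, F c - 2 * τ * ∑ c ∈ G, F c * t c) := by
      rw [Finset.mul_sum, Finset.mul_sum, ← Finset.sum_sub_distrib, Finset.mul_sum]
      exact Finset.sum_congr rfl fun c _ => by ring
    rw [h1, hsum, ← hτ]
    ring
  have hpt : 0 ≤ ∑ c ∈ G, (K ^ 2 * t c ^ 2 - D * (n c * (F c * (t c - τ)) ^ 2) +
      D * K * (F c * ((t c - τ) ^ 2 - t c ^ 2 + τ ^ 2))) := by
    refine Finset.sum_nonneg fun c hc => ?_
    have h1 : 0 ≤ D * F c * (t c - τ) ^ 2 * (2 * K - (D + n c) * F c) :=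
      mul_nonneg (mul_nonneg (mul_nonneg hD (hF c hc)) (sq_nonneg _))
        (sub_nonneg.2 (hK c hc))
    nlinarith [sq_nonneg ((D * F c - K) * t c - D * F c * τ)]
  rw [Finset.sum_add_distrib, hvar, Finset.sum_sub_distrib, ← Finset.mul_sum,
    ← Finset.mul_sum] at hpt
  linarith

/-- The Gibbs weights `exp (E c) / ∑_{c' ∈ G} exp (E c')`; meaningful for `c ∈ G`. -/
def softmax {κ : Type*} (G : Finset κ) (E : κ → ℝ) (c : κ) : ℝ :=
  Real.exp (E c) / ∑ c' ∈ G, Real.exp (E c')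

theorem sum_exp_pos {κ : Type*} {G : Finset κ} (hG : G.Nonempty) (E : κ → ℝ) :
    0 < ∑ c ∈ G, Real.exp (E c) :=
  Finset.sum_pos (fun _ _ => Real.exp_pos _) hG

theorem softmax_nonneg {κ : Type*} (G : Finset κ) (E : κ → ℝ) (c : κ) : 0 ≤ softmax G E c :=
  div_nonneg (Real.exp_pos _).le (Finset.sum_nonneg fun _ _ => (Real.exp_pos _).le)

theorem sum_softmax {κ : Type*} {G : Finset κ} (hG : G.Nonempty) (E : κ → ℝ) :
    ∑ c ∈ G, softmax G E c = 1 := by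
  simp only [softmax]
  rw [← Finset.sum_div, div_self (sum_exp_pos hG E).ne']

theorem hasDerivAt_softmax {κ : Type*} {G : Finset κ} (hG : G.Nonempty) {E : ℝ → κ → ℝ}
    {w : κ → ℝ} {s : ℝ} (hE : ∀ c ∈ G, HasDerivAt (fun r => E r c) (w c) s) {c : κ} (hc : c ∈ G) :
    HasDerivAt (fun r => softmax G (E r) c)
      (softmax G (E s) c * (w c - ∑ c' ∈ G, softmax G (E s) c' * w c')) s := by
  have hZ := (sum_exp_pos hG (E s)).ne'
  have h1 : HasDerivAt (fun r => ∑ c' ∈ G, Real.exp (E r c'))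
      (∑ c' ∈ G, Real.exp (E s c') * w c') s :=
    HasDerivAt.fun_sum fun c' hc' => (hE c' hc').exp
  have h2 := (hE c hc).exp.fun_div h1 hZ
  have h3 : ∑ c' ∈ G, softmax G (E s) c' * w c' =
      (∑ c' ∈ G, Real.exp (E s c') * w c') / ∑ c' ∈ G, Real.exp (E s c') := by
    rw [Finset.sum_div]
    exact Finset.sum_congr rfl fun c' _ => by simp only [softmax]; ring
  refine h2.congr_deriv ?_
  rw [h3]
  simp only [softmax]
  field_simp

/-- The logarithm `∑_{i ∈ I} log (1 - x_i(c))` of the belief propagation weight of `c`. -/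
def logWeight {ι κ : Type*} (I : Finset ι) (x : ι → κ → ℝ) (c : κ) : ℝ :=
  ∑ i ∈ I, Real.log (1 - x i c)

/-- If `(#I + n_c) F_c ≤ 2 K` along the segment from `x` to `x'`, where `n_c` counts the `i` with
`c ∉ A i` and `x`, `x'` agree on the sets `A i`, then the softmax of the log-weights moves by at
most `K / (1 - θ)` times the largest move of an `x_i`, in the Euclidean norm. -/
theorem softmax_logWeight_contraction {ι κ : Type*} {G : Finset κ} (hG : G.Nonempty)
    (I : Finset ι) (A : ι → Finset κ) [DecidableEq κ] {x x' : ι → κ → ℝ} {θ K m : ℝ}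
    (hθ : θ < 1) (hm0 : 0 ≤ m) (hm : ∀ i ∈ I, ∑ c ∈ G, (x' i c - x i c) ^ 2 ≤ m)
    (hx : ∀ i ∈ I, ∀ c ∈ G, x i c ≤ θ) (hx' : ∀ i ∈ I, ∀ c ∈ G, x' i c ≤ θ)
    (hA : ∀ i ∈ I, ∀ c ∈ A i, x i c = x' i c)
    (hK : ∀ s ∈ Set.Ioo (0 : ℝ) 1, ∀ c ∈ G, ((#I : ℝ) + (#{i ∈ I | c ∉ A i} : ℝ)) *
      softmax G (logWeight I fun i c => x i c + s * (x' i c - x i c)) c ≤ 2 * K) :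
    ∑ c ∈ G, (softmax G (logWeight I x') c - softmax G (logWeight I x) c) ^ 2 ≤
      (K / (1 - θ)) ^ 2 * m := by
  set X : ℝ → ι → κ → ℝ := fun s i c => x i c + s * (x' i c - x i c) with hX
  have hX0 : X 0 = x := by funext i c; simp [hX]
  have hX1 : X 1 = x' := by funext i c; simp [hX]
  have hXθ : ∀ s ∈ Set.Icc (0 : ℝ) 1, ∀ i ∈ I, ∀ c ∈ G, 1 - θ ≤ 1 - X s i c := by
    intro s hs i hi c hc
    have h1 := mul_le_mul_of_nonneg_left (hx i hi c hc) (sub_nonneg.2 hs.2)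
    have h2 := mul_le_mul_of_nonneg_left (hx' i hi c hc) hs.1
    simp only [hX]
    nlinarith
  have h1θ : 0 < 1 - θ := by linarith
  set u : ℝ → ι → κ → ℝ := fun s i c => -(x' i c - x i c) / (1 - X s i c) with hu
  set w : ℝ → κ → ℝ := fun s c => ∑ i ∈ I, u s i c with hw
  set F : ℝ → κ → ℝ := fun s => softmax G (logWeight I (X s)) with hF
  have hEder : ∀ s ∈ Set.Icc (0 : ℝ) 1, ∀ c ∈ G,
      HasDerivAt (fun r => logWeight I (X r) c) (w s c) s := by
    intro s hs c hc
    refine HasDerivAt.fun_sum fun i hi => ?_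
    have h1 : HasDerivAt (fun r => 1 - X r i c) (-(x' i c - x i c)) s := by
      have := (((hasDerivAt_id s).mul_const (x' i c - x i c)).const_add (x i c)).const_sub 1
      simpa [hX] using this
    exact h1.log (by linarith [hXθ s hs i hi c hc])
  set t : κ → ℝ := fun c => F 1 c - F 0 c with ht
  have hder : ∀ s ∈ Set.Icc (0 : ℝ) 1, HasDerivAt (fun r => ∑ c ∈ G, t c * F r c)
      (∑ c ∈ G, t c * (F s c * (w s c - ∑ c' ∈ G, F s c' * w s c'))) s := fun s hs =>
    HasDerivAt.fun_sum fun c hc => (hasDerivAt_softmax hG (hEder s hs) hc).const_mul (t c)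
  -- The mean value theorem for the component of `F` in the direction `t = F 1 - F 0`, whose
  -- increment is `∑ t ^ 2`.
  obtain ⟨s, hs, hslope⟩ := exists_hasDerivAt_eq_slope (fun r => ∑ c ∈ G, t c * F r c)
    (fun s => ∑ c ∈ G, t c * (F s c * (w s c - ∑ c' ∈ G, F s c' * w s c'))) zero_lt_one
    (fun s hs => (hder s hs).continuousAt.continuousWithinAt)
    (fun s hs => hder s (Set.Ioo_subset_Icc_self hs))
  have hs' := Set.Ioo_subset_Icc_self hs
  set T := ∑ c ∈ G, t c ^ 2 with hT
  have hT0 : 0 ≤ T := Finset.sum_nonneg fun _ _ => sq_nonneg _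
  set τ := ∑ c ∈ G, F s c * t c with hτ
  have hTeq : T = ∑ c ∈ G, ∑ i ∈ I with c ∉ A i, (F s c * (t c - τ)) * u s i c := by
    have h1 : T = ∑ c ∈ G, t c * (F s c * (w s c - ∑ c' ∈ G, F s c' * w s c')) := by
      rw [hslope, sub_zero, div_one, ← Finset.sum_sub_distrib]
      exact Finset.sum_congr rfl fun c _ => by simp only [ht]; ring
    have h2 : T = ∑ c ∈ G, (F s c * (t c - τ)) * w s c := by
      have e1 : ∑ c ∈ G, t c * (F s c * (w s c - ∑ c' ∈ G, F s c' * w s c')) =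
          ∑ c ∈ G, F s c * t c * w s c - τ * ∑ c' ∈ G, F s c' * w s c' := by
        rw [hτ, Finset.sum_mul, ← Finset.sum_sub_distrib]
        exact Finset.sum_congr rfl fun c _ => by ring
      rw [h1, e1, Finset.mul_sum, ← Finset.sum_sub_distrib]
      exact Finset.sum_congr rfl fun c _ => by ring
    rw [h2]
    refine Finset.sum_congr rfl fun c _ => ?_
    rw [hw, Finset.mul_sum, Finset.sum_filter]
    refine Finset.sum_congr rfl fun i hi => ?_
    by_cases hc : c ∈ A i
    · simp [hc, hu, hA i hi c hc]
    · simp [hc]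
  have hCS : T ^ 2 ≤ (∑ c ∈ G, (#{i ∈ I | c ∉ A i} : ℝ) * (F s c * (t c - τ)) ^ 2) *
      ∑ i ∈ I, ∑ c ∈ G, u s i c ^ 2 := by
    have h1 := Finset.sum_mul_sq_le_sq_mul_sq (G.sigma fun c => {i ∈ I | c ∉ A i})
      (fun p => F s p.1 * (t p.1 - τ)) (fun p => u s p.2 p.1)
    rw [Finset.sum_sigma, Finset.sum_sigma, Finset.sum_sigma, ← hTeq] at h1
    simp only [Finset.sum_const, nsmul_eq_mul] at h1
    refine h1.trans (mul_le_mul_of_nonneg_left ?_ ?_)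
    · rw [Finset.sum_comm (s := I)]
      exact Finset.sum_le_sum fun c _ => Finset.sum_le_sum_of_subset_of_nonneg
        (Finset.filter_subset _ _) fun _ _ _ => sq_nonneg _
    · exact Finset.sum_nonneg fun c _ => mul_nonneg (Nat.cast_nonneg _) (sq_nonneg _)
  have hU : ∑ i ∈ I, ∑ c ∈ G, u s i c ^ 2 ≤ #I * (m / (1 - θ) ^ 2) := by
    rw [← nsmul_eq_mul]
    refine Finset.sum_le_card_nsmul _ _ _ fun i hi => ?_
    refine le_trans ?_ (div_le_div_of_nonneg_right (hm i hi) (sq_nonneg _))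
    rw [Finset.sum_div]
    refine Finset.sum_le_sum fun c hc => ?_
    have h1 := hXθ s hs' i hi c hc
    simp only [hu]
    rw [div_pow, neg_sq]
    gcongr
  have hvar := weighted_variance_le G (F s) (fun c => (#{i ∈ I | c ∉ A i} : ℝ)) t
    (D := (#I : ℝ)) (K := K) (Nat.cast_nonneg _) (fun c _ => softmax_nonneg _ _ _)
    (sum_softmax hG _) (hK s hs)
  rw [← hτ] at hvar
  have hT2 : T * T ≤ ((K / (1 - θ)) ^ 2 * m) * T := by
    have hV0 : 0 ≤ ∑ c ∈ G, (#{i ∈ I | c ∉ A i} : ℝ) * (F s c * (t c - τ)) ^ 2 :=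
      Finset.sum_nonneg fun c _ => mul_nonneg (Nat.cast_nonneg _) (sq_nonneg _)
    calc T * T = T ^ 2 := by ring
      _ ≤ _ := hCS
      _ ≤ _ := mul_le_mul_of_nonneg_left hU hV0
      _ = ((#I : ℝ) * ∑ c ∈ G, (#{i ∈ I | c ∉ A i} : ℝ) * (F s c * (t c - τ)) ^ 2) *
          (m / (1 - θ) ^ 2) := by ring
      _ ≤ (K ^ 2 * T) * (m / (1 - θ) ^ 2) :=
        mul_le_mul_of_nonneg_right hvar (div_nonneg hm0 (sq_nonneg _))
      _ = _ := by rw [div_pow]; ring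
  have hgoal : ∑ c ∈ G, (softmax G (logWeight I x') c - softmax G (logWeight I x) c) ^ 2 = T := by
    simp only [hT, ht, hF, hX0, hX1]
  rw [hgoal]
  rcases hT0.eq_or_lt with h0 | hpos
  · rw [← h0]
    exact mul_nonneg (sq_nonneg _) hm0
  · exact le_of_mul_le_mul_right hT2 hpos

/-! ### Bounds for the softmax and the numerical constants -/

theorem neg_div_le_log_one_sub {x θ : ℝ} (h0 : 0 ≤ x) (hx : x ≤ θ) (hθ : θ < 1) :
    -(x / (1 - θ)) ≤ Real.log (1 - x) := by
  have h1 : 0 < 1 - x := by linarith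
  have h2 := Real.one_sub_inv_le_log_of_pos h1
  have h3 : 1 - (1 - x)⁻¹ = -(x / (1 - x)) := by field_simp; ring
  have h4 : x / (1 - x) ≤ x / (1 - θ) :=
    div_le_div_of_nonneg_left h0 (by linarith) (by linarith)
  linarith

/-- The denominator is bounded below by the inequality of arithmetic and geometric means over the
colors in `G`; the numerator loses a factor `exp (-L)` for each `i` with `c ∉ A i`. -/
theorem softmax_logWeight_le {ι κ : Type*} {G : Finset κ} (hG : G.Nonempty) (I : Finset ι)
    (A : ι → Finset κ) [DecidableEq κ] {x : ι → κ → ℝ} {θ L : ℝ} (hθ : θ < 1)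
    (h0 : ∀ i ∈ I, ∀ c ∈ G, 0 ≤ x i c) (hx : ∀ i ∈ I, ∀ c ∈ G, x i c ≤ θ)
    (hsum : ∀ i ∈ I, ∑ c ∈ G, x i c ≤ 1) (hL : ∀ i ∈ I, ∀ c ∈ G, c ∉ A i → L ≤ x i c)
    {c : κ} (hc : c ∈ G) :
    softmax G (logWeight I x) c ≤
      1 / #G * Real.exp (#I / #G / (1 - θ) - #{i ∈ I | c ∉ A i} * L) := by
  have hθ' : 0 < 1 - θ := by linarith
  have hGpos : (0 : ℝ) < #G := by exact_mod_cast hG.card_pos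
  have hnum : logWeight I x c ≤ -(#{i ∈ I | c ∉ A i} * L) := by
    have h1 : logWeight I x c ≤ ∑ i ∈ I, if c ∉ A i then -L else 0 := by
      refine Finset.sum_le_sum fun i hi => ?_
      have h2 : Real.log (1 - x i c) ≤ -x i c := by
        have := Real.log_le_sub_one_of_pos (x := 1 - x i c) (by linarith [hx i hi c hc])
        linarith
      split_ifs with h
      · linarith [h0 i hi c hc]
      · linarith [hL i hi c hc h]
    rw [← Finset.sum_filter, Finset.sum_const, nsmul_eq_mul] at h1
    linarith
  set μ : ℝ := #I / #G / (1 - θ) with hμ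
  have hden : #G * Real.exp (-μ) ≤ ∑ c' ∈ G, Real.exp (logWeight I x c') := by
    have hE : -(#I / (1 - θ)) ≤ ∑ c' ∈ G, logWeight I x c' := by
      have h1 : ∑ c' ∈ G, logWeight I x c' = ∑ i ∈ I, ∑ c' ∈ G, Real.log (1 - x i c') := by
        simp only [logWeight]
        exact Finset.sum_comm
      rw [h1, ← mul_one_div, ← mul_neg, ← nsmul_eq_mul]
      refine Finset.card_nsmul_le_sum _ _ _ fun i hi => ?_
      calc -(1 / (1 - θ)) ≤ -((∑ c' ∈ G, x i c') / (1 - θ)) :=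
            neg_le_neg (div_le_div_of_nonneg_right (hsum i hi) hθ'.le)
        _ = ∑ c' ∈ G, -(x i c' / (1 - θ)) := by rw [Finset.sum_div, Finset.sum_neg_distrib]
        _ ≤ _ := Finset.sum_le_sum fun c' hc' =>
          neg_div_le_log_one_sub (h0 i hi c' hc') (hx i hi c' hc') hθ
    have h2 : ∀ c' ∈ G, Real.exp (-μ) * (logWeight I x c' + μ + 1) ≤
        Real.exp (logWeight I x c') := by
      intro c' _
      have : Real.exp (logWeight I x c') = Real.exp (-μ) * Real.exp (logWeight I x c' + μ) := by
        rw [← Real.exp_add]; congr 1; ring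
      rw [this]
      exact mul_le_mul_of_nonneg_left (Real.add_one_le_exp _) (Real.exp_pos _).le
    refine le_trans ?_ (Finset.sum_le_sum h2)
    rw [← Finset.mul_sum, Finset.sum_add_distrib, Finset.sum_add_distrib, Finset.sum_const,
      Finset.sum_const, nsmul_eq_mul, nsmul_eq_mul, mul_comm]
    refine mul_le_mul_of_nonneg_left ?_ (Real.exp_pos _).le
    have h3 : (#G : ℝ) * μ = #I / (1 - θ) := by rw [hμ]; field_simp
    rw [h3]
    linarith
  calc softmax G (logWeight I x) c
      ≤ Real.exp (-(#{i ∈ I | c ∉ A i} * L)) / (#G * Real.exp (-μ)) := by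
        unfold softmax
        have := Real.exp_pos (-μ)
        exact div_le_div₀ (Real.exp_pos _).le (Real.exp_le_exp.2 hnum) (by positivity) hden
    _ = _ := by
      rw [sub_eq_add_neg, Real.exp_add, Real.exp_neg μ]
      field_simp

theorem exp_le_of_le_contraction_exponent {z : ℝ} (hz : z ≤ 0.7368 / 1.59 + 0.00001) :
    Real.exp z ≤ 0.9998 * 1.59 := by
  refine (Real.exp_le_exp.2 hz).trans ?_
  refine (Real.exp_bound' (by norm_num) (by norm_num) (n := 8) (by norm_num)).trans ?_
  norm_num [Finset.sum_range_succ, Nat.factorial]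

theorem exp_inv_le : Real.exp (1 / 0.59) ≤ 5.4463 := by
  have h : Real.exp (1 / 0.59) = Real.exp (0.5 / 0.59) ^ 2 := by
    rw [← Real.exp_nat_mul]; norm_num
  rw [h]
  have h1 : Real.exp (0.5 / 0.59) ≤ 2.33373 := by
    refine (Real.exp_bound' (by norm_num) (by norm_num) (n := 12) (by norm_num)).trans ?_
    norm_num [Finset.sum_range_succ, Nat.factorial]
  calc Real.exp (0.5 / 0.59) ^ 2 ≤ 2.33373 ^ 2 := by gcongr
    _ ≤ _ := by norm_num

/-- The contraction factor, with `D` free children, `Q` available colors, and `n` free children that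
can take the given color. For `Q = q - d + D` the expression increases in `n` and in `D`, so that
the extreme case is `n = D = d` and `Q = q`, with `d / q = 1 / 1.59`. -/
theorem contraction_factor_le {q d D Q n θ : ℝ} (hd : 0 ≤ d) (hq : 1.59 * d + 10 ^ 6 ≤ q)
    (hD : 0 ≤ D) (hDd : D ≤ d) (hQ : q - d + D ≤ Q) (hnD : n ≤ D)
    (hθ0 : 0 ≤ θ) (hθ : θ ≤ 1 / 10 ^ 6) :
    (D + n) * (1 / Q * Real.exp (D / Q / (1 - θ) - n * (0.2632 / q))) ≤ 2 * 0.9998 := by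
  have hq0 : 0 < q := by linarith
  have hR : 0 < q - d + D := by linarith
  have hQ0 : 0 < Q := by linarith
  -- This makes `n ↦ (D + n) exp (-n ℓ / q)` increasing on `[0, D]`.
  have hDq : D * (0.2632 / q) ≤ 1 / 2 := by
    rw [← mul_div_assoc, div_le_iff₀ hq0]; linarith
  have hn : (D + n) ≤ 2 * D * Real.exp (-((D - n) * (0.2632 / q))) := by
    have h1 := Real.add_one_le_exp (-((D - n) * (0.2632 / q)))
    have h2 := mul_le_mul_of_nonneg_left h1 hD
    have h3 := mul_le_mul_of_nonneg_left hDq (sub_nonneg.2 hnD)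
    nlinarith
  set a := D / Q with ha
  have haR : a ≤ D / (q - d + D) := div_le_div_of_nonneg_left hD hR hQ
  have ha0 : 0 ≤ a := div_nonneg hD hQ0.le
  have ha1 : a ≤ 1 / 1.59 := by
    refine haR.trans ?_
    rw [div_le_div_iff₀ hR (by norm_num)]
    linarith
  have hexp : a / (1 - θ) - D * (0.2632 / q) ≤ 0.7368 / 1.59 + 0.00001 := by
    have h1 : a / (1 - θ) ≤ a + 0.00001 := by
      rw [div_le_iff₀ (by linarith)]
      have h2 := mul_le_mul ha1 hθ hθ0 (by norm_num)
      nlinarith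
    have h2 : D / (q - d + D) ≤ D * (0.2632 / q) + 0.7368 * (d / q) := by
      rw [← mul_div_assoc, ← mul_div_assoc, ← add_div, div_le_div_iff₀ hR hq0]
      have h3 : 0 ≤ (d - D) * (0.7368 * q - d + 0.2632 * (d - D)) :=
        mul_nonneg (by linarith) (by linarith)
      nlinarith
    have h3 : d / q ≤ 1 / 1.59 := by
      rw [div_le_div_iff₀ hq0 (by norm_num)]; linarith
    linarith
  calc (D + n) * (1 / Q * Real.exp (a / (1 - θ) - n * (0.2632 / q)))
      ≤ (2 * D * Real.exp (-((D - n) * (0.2632 / q)))) *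
        (1 / Q * Real.exp (a / (1 - θ) - n * (0.2632 / q))) :=
        mul_le_mul_of_nonneg_right hn (by positivity)
    _ = 2 * (a * Real.exp (a / (1 - θ) - D * (0.2632 / q))) := by
      have : a / (1 - θ) - D * (0.2632 / q) =
        -((D - n) * (0.2632 / q)) + (a / (1 - θ) - n * (0.2632 / q)) := by ring
      rw [this, Real.exp_add, ha]
      ring
    _ ≤ 2 * (1 / 1.59 * (0.9998 * 1.59)) := by
      have := exp_le_of_le_contraction_exponent hexp
      gcongr
    _ = _ := by norm_num

/-! ### Belief propagation -/

/-- The belief propagation map `y ↦ ∏ᵢ (1 - y_i(c)) / ∑_{c'} ∏ᵢ (1 - y_i(c'))` for colorings. -/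
def beliefPropagation {ι κ : Type*} [Fintype ι] [Fintype κ] (y : ι → κ → ℝ) (c : κ) : ℝ :=
  (∏ i, (1 - y i c)) / ∑ c', ∏ i, (1 - y i c')

/-- The indices that `k` leaves free; `k i = some a` means that `i` is pinned to `a`. -/
def freeIndices {ι κ : Type*} [Fintype ι] (k : ι → Option κ) : Finset ι :=
  {i | k i = none}

theorem mem_freeIndices {ι κ : Type*} [Fintype ι] {k : ι → Option κ} {i : ι} :
    i ∈ freeIndices k ↔ k i = none := by
  simp [freeIndices]

theorem exp_neg_mul_le_pow {θ : ℝ} (hθ0 : 0 ≤ θ) (hθ : θ ≤ 1) (m : ℕ) :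
    (1 - m * θ ^ 2) * Real.exp (-(m * θ)) ≤ (1 - θ) ^ m := by
  have h1 : (1 - θ ^ 2) * Real.exp (-θ) ≤ 1 - θ := by
    rw [Real.exp_neg, ← div_eq_mul_inv, div_le_iff₀ (Real.exp_pos _)]
    nlinarith [mul_le_mul_of_nonneg_left (Real.add_one_le_exp θ) (sub_nonneg.2 hθ)]
  have h2 : 1 - m * θ ^ 2 ≤ (1 - θ ^ 2) ^ m := by
    have := one_add_mul_le_pow (a := -θ ^ 2) (by nlinarith) m
    calc 1 - m * θ ^ 2 = 1 + m * -θ ^ 2 := by ring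
      _ ≤ _ := this
      _ = _ := by ring
  have h3 : 0 ≤ 1 - θ ^ 2 := by nlinarith
  calc (1 - m * θ ^ 2) * Real.exp (-(m * θ))
      ≤ (1 - θ ^ 2) ^ m * Real.exp (-(m * θ)) :=
        mul_le_mul_of_nonneg_right h2 (Real.exp_pos _).le
    _ = ((1 - θ ^ 2) * Real.exp (-θ)) ^ m := by
      rw [mul_pow, ← Real.exp_nat_mul, mul_neg]
    _ ≤ _ := pow_le_pow_left₀ (mul_nonneg h3 (Real.exp_pos _).le) h1 m

section BeliefPropagation

variable {ι κ : Type*}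

theorem le_one_of_mem_stdSimplex [Fintype κ] {y : κ → ℝ} (hy : y ∈ stdSimplex ℝ κ) (c : κ) :
    y c ≤ 1 :=
  hy.2 ▸ Finset.single_le_sum (fun c _ => hy.1 c) (Finset.mem_univ c)

/-- The Weierstrass product inequality. -/
theorem one_sub_sum_le_prod {I : Finset ι} {f : ι → ℝ} (h0 : ∀ i, 0 ≤ f i) (h1 : ∀ i, f i ≤ 1) :
    1 - ∑ i ∈ I, f i ≤ ∏ i ∈ I, (1 - f i) := by
  classical
  induction I using Finset.induction_on with
  | empty => simp
  | insert i I hi ih =>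
    rw [Finset.sum_insert hi, Finset.prod_insert hi]
    have hp : ∏ j ∈ I, (1 - f j) ≤ 1 :=
      Finset.prod_le_one (fun j _ => sub_nonneg.2 (h1 j)) fun j _ => sub_le_self _ (h0 j)
    nlinarith [mul_le_mul_of_nonneg_left hp (h0 i)]

variable [Fintype ι] [Fintype κ]

/-- The expected number of colors missed by independent samples from the `y i`. -/
theorem card_sub_card_le_sum_prod {y : ι → κ → ℝ} (hy : ∀ i, y i ∈ stdSimplex ℝ κ) :
    (Fintype.card κ : ℝ) - Fintype.card ι ≤ ∑ c, ∏ i, (1 - y i c) := by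
  have h1 : ∑ c, (1 - ∑ i, y i c) = (Fintype.card κ : ℝ) - Fintype.card ι := by
    rw [Finset.sum_sub_distrib, Finset.sum_comm]
    simp [fun i => (hy i).2]
  rw [← h1]
  exact Finset.sum_le_sum fun c _ => one_sub_sum_le_prod (fun i => (hy i).1 c)
    fun i => le_one_of_mem_stdSimplex (hy i) c

theorem beliefPropagation_le {y : ι → κ → ℝ} (hy : ∀ i, y i ∈ stdSimplex ℝ κ)
    (hcard : Fintype.card ι < Fintype.card κ) (c : κ) :
    beliefPropagation y c ≤ 1 / ((Fintype.card κ : ℝ) - Fintype.card ι) := by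
  refine div_le_div₀ zero_le_one ?_ (sub_pos.2 (by exact_mod_cast hcard))
    (card_sub_card_le_sum_prod hy)
  exact Finset.prod_le_one (fun i _ => sub_nonneg.2 (le_one_of_mem_stdSimplex (hy i) c))
    fun i _ => sub_le_self _ ((hy i).1 c)

/-- The weight of `c` is at most `exp (-∑ y_i(c))`, and the exponential is replaced by its chord on
`[-#I θ, 0]`, with `I` the set of free indices. -/
theorem sum_prod_one_sub_le {k : ι → Option κ} {y : ι → κ → ℝ} {θ : ℝ} (hθ : 0 < θ)
    (hy : ∀ i, y i ∈ stdSimplex ℝ κ) (hyθ : ∀ i ∈ freeIndices k, ∀ c, y i c ≤ θ) :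
    ∑ c, ∏ i, (1 - y i c) ≤
      Fintype.card κ - 1 / θ * (1 - Real.exp (-(#(freeIndices k) * θ))) := by
  set I := freeIndices k with hI
  have h1 : ∀ c, ∏ i, (1 - y i c) ≤ Real.exp (-∑ i ∈ I, y i c) := by
    intro c
    have hnn : ∀ i, 0 ≤ 1 - y i c := fun i => sub_nonneg.2 (le_one_of_mem_stdSimplex (hy i) c)
    calc ∏ i, (1 - y i c) ≤ ∏ i ∈ I, (1 - y i c) := by
          classical
          rw [← Finset.prod_sdiff (Finset.subset_univ I)]
          exact mul_le_of_le_one_left (Finset.prod_nonneg fun i _ => hnn i)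
            (Finset.prod_le_one (fun i _ => hnn i) fun i _ => sub_le_self _ ((hy i).1 c))
      _ ≤ ∏ i ∈ I, Real.exp (-y i c) :=
          Finset.prod_le_prod (fun i _ => hnn i) fun i _ => Real.one_sub_le_exp_neg _
      _ = _ := by rw [← Real.exp_sum, Finset.sum_neg_distrib]
  -- Without free indices the chord degenerates to a point.
  rcases I.eq_empty_or_nonempty with h | h
  · refine (Finset.sum_le_sum fun c _ => h1 c).trans ?_
    simp [h]
  set M : ℝ := #I * θ with hM
  have hm : (0 : ℝ) < #I := by exact_mod_cast h.card_pos
  have hM0 : 0 < M := mul_pos hm hθ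
  have h2 : ∀ c, Real.exp (-∑ i ∈ I, y i c) ≤ 1 - (∑ i ∈ I, y i c) / M * (1 - Real.exp (-M)) := by
    intro c
    have hY0 : 0 ≤ (∑ i ∈ I, y i c) / M :=
      div_nonneg (Finset.sum_nonneg fun i _ => (hy i).1 c) hM0.le
    have hY1 : (∑ i ∈ I, y i c) / M ≤ 1 := by
      rw [div_le_one hM0, hM, ← nsmul_eq_mul]
      exact Finset.sum_le_card_nsmul _ _ _ fun i hi => hyθ i hi c
    have h3 := convexOn_exp.2 (Set.mem_univ 0) (Set.mem_univ (-M)) (sub_nonneg.2 hY1) hY0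
      (sub_add_cancel _ _)
    have h4 : -∑ i ∈ I, y i c = (∑ i ∈ I, y i c) / M * -M := by field_simp
    rw [h4]
    simp only [smul_eq_mul, mul_zero, zero_add, Real.exp_zero, mul_one] at h3
    linarith
  refine (Finset.sum_le_sum fun c _ => (h1 c).trans (h2 c)).trans_eq ?_
  have h5 : ∑ c, ∑ i ∈ I, y i c = #I := by
    rw [Finset.sum_comm]
    simp [fun i => (hy i).2]
  rw [Finset.sum_sub_distrib, ← Finset.sum_mul, ← Finset.sum_div, h5, hM]
  simp only [Finset.sum_const, Finset.card_univ, nsmul_eq_mul, mul_one]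
  congr 2
  field_simp

variable [DecidableEq κ]

/-- The colors to which `k` pins no index. -/
def availableColors (k : ι → Option κ) : Finset κ :=
  {c | ∀ i, k i ≠ some c}

theorem mem_availableColors {k : ι → Option κ} {c : κ} :
    c ∈ availableColors k ↔ ∀ i, k i ≠ some c := by
  simp [availableColors]

theorem card_availableColors_ge (k : ι → Option κ) :
    (Fintype.card κ : ℝ) - Fintype.card ι + #(freeIndices k) ≤ #(availableColors k) := by
  classical
  have h1 : #(availableColors k)ᶜ ≤ #(freeIndices k)ᶜ := by
    rw [← Finset.card_map (Function.Embedding.some : κ ↪ Option κ)]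
    refine (Finset.card_le_card fun o ho => ?_).trans (Finset.card_image_le (f := k))
    obtain ⟨c, hc, rfl⟩ := Finset.mem_map.1 ho
    rw [Finset.mem_compl, mem_availableColors] at hc
    push Not at hc
    obtain ⟨i, hi⟩ := hc
    refine Finset.mem_image.2 ⟨i, ?_, hi⟩
    rw [Finset.mem_compl, mem_freeIndices, hi]
    exact Option.some_ne_none c
  have h2 := Finset.card_add_card_compl (availableColors k)
  have h3 := Finset.card_add_card_compl (freeIndices k)
  have h4 : Fintype.card κ + #(freeIndices k) ≤ #(availableColors k) + Fintype.card ι := by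
    omega
  have h5 : (Fintype.card κ : ℝ) + #(freeIndices k) ≤ #(availableColors k) + Fintype.card ι := by
    exact_mod_cast h4
  linarith

theorem prod_one_sub_eq {k : ι → Option κ} {y : ι → κ → ℝ}
    (hk : ∀ i a, k i = some a → y i = Pi.single a 1) {c : κ} (hc : c ∈ availableColors k) :
    ∏ i, (1 - y i c) = ∏ i ∈ freeIndices k, (1 - y i c) := by
  refine (Finset.prod_subset (Finset.subset_univ _) fun i _ hi => ?_).symm
  rw [mem_freeIndices] at hi
  obtain ⟨a, ha⟩ := Option.ne_none_iff_exists'.1 hi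
  have hca : c ≠ a := fun h => mem_availableColors.1 hc i (h ▸ ha)
  simp [hk i a ha, hca]

theorem prod_one_sub_eq_zero {k : ι → Option κ} {y : ι → κ → ℝ}
    (hk : ∀ i a, k i = some a → y i = Pi.single a 1) {c : κ} (hc : c ∉ availableColors k) :
    ∏ i, (1 - y i c) = 0 := by
  rw [mem_availableColors] at hc
  push Not at hc
  obtain ⟨i, hi⟩ := hc
  exact Finset.prod_eq_zero (Finset.mem_univ i) (by simp [hk i c hi])

theorem beliefPropagation_eq_zero {k : ι → Option κ} {y : ι → κ → ℝ}
    (hk : ∀ i a, k i = some a → y i = Pi.single a 1) {c : κ} (hc : c ∉ availableColors k) :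
    beliefPropagation y c = 0 := by
  rw [beliefPropagation, prod_one_sub_eq_zero hk hc, zero_div]

theorem beliefPropagation_eq_softmax {k : ι → Option κ} {y : ι → κ → ℝ}
    (hk : ∀ i a, k i = some a → y i = Pi.single a 1)
    (hlt : ∀ i ∈ freeIndices k, ∀ c, y i c < 1) {c : κ} (hc : c ∈ availableColors k) :
    beliefPropagation y c = softmax (availableColors k) (logWeight (freeIndices k) y) c := by
  have h1 : ∀ c ∈ availableColors k,
      ∏ i, (1 - y i c) = Real.exp (logWeight (freeIndices k) y c) := by
    intro c hc
    rw [prod_one_sub_eq hk hc, logWeight, Real.exp_sum]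
    exact Finset.prod_congr rfl fun i hi =>
      (Real.exp_log (sub_pos.2 (hlt i hi c))).symm
  rw [beliefPropagation, softmax, h1 c hc]
  congr 1
  rw [← Finset.sum_subset (Finset.subset_univ (availableColors k))
    fun c _ hc => prod_one_sub_eq_zero hk hc]
  exact Finset.sum_congr rfl h1

/-- The extreme case is that of `d` free indices: the weight of `c` is then about `exp (-b)` and the
total weight at most `d + (q - d) exp (-b)`, for `b = d / (q - d) ≤ 1 / 0.59`. -/
theorem beliefPropagation_ge {k : ι → Option κ} {y : ι → κ → ℝ}
    (hq : 1.59 * (Fintype.card ι : ℝ) + 10 ^ 6 ≤ Fintype.card κ)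
    (hk : ∀ i a, k i = some a → y i = Pi.single a 1) (hy : ∀ i, y i ∈ stdSimplex ℝ κ)
    (hyθ : ∀ i ∈ freeIndices k, ∀ c, y i c ≤ 1 / ((Fintype.card κ : ℝ) - Fintype.card ι))
    {c : κ} (hc : c ∈ availableColors k) :
    0.2632 / Fintype.card κ ≤ beliefPropagation y c := by
  set q := (Fintype.card κ : ℝ) with hqdef
  set d := (Fintype.card ι : ℝ) with hddef
  have hd0 : 0 ≤ d := Nat.cast_nonneg _
  have hqd : 0 < q - d := by linarith
  have hq0 : 0 < q := by linarith
  set θ : ℝ := 1 / (q - d) with hθ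
  have hθ0 : 0 < θ := one_div_pos.2 hqd
  have hθ6 : θ ≤ 1 / 10 ^ 6 := one_div_le_one_div_of_le (by norm_num) (by linarith)
  set m := #(freeIndices k) with hm
  have hmd : (m : ℝ) ≤ d := by
    rw [hm, hddef]; exact_mod_cast Finset.card_le_univ _
  have hM : m * θ ≤ 1 / 0.59 := by
    rw [hθ, mul_one_div, div_le_div_iff₀ hqd (by norm_num)]
    linarith
  have hnum : (1 - m * θ ^ 2) * Real.exp (-(m * θ)) ≤ ∏ i, (1 - y i c) := by
    rw [prod_one_sub_eq hk hc]
    refine (exp_neg_mul_le_pow hθ0.le (hθ6.trans (by norm_num)) m).trans ?_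
    rw [hm, ← Finset.prod_const]
    exact Finset.prod_le_prod (fun _ _ => by linarith) fun i hi => by linarith [hyθ i hi c]
  have hden := sum_prod_one_sub_le hθ0 hy hyθ
  have hpos : 0 < ∑ c, ∏ i, (1 - y i c) := hqd.trans_le (card_sub_card_le_sum_prod hy)
  rw [beliefPropagation, div_le_div_iff₀ hq0 hpos]
  refine (mul_le_mul_of_nonneg_left hden (by norm_num)).trans
    (le_trans ?_ (mul_le_mul_of_nonneg_right hnum hq0.le))
  rw [← hm, ← hqdef]
  have h1θ : 1 / θ = q - d := by rw [hθ, one_div_one_div]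
  have he : Real.exp (m * θ) ≤ 5.4463 := (Real.exp_le_exp.2 hM).trans exp_inv_le
  have hee : Real.exp (m * θ) * Real.exp (-(m * θ)) = 1 := by
    rw [← Real.exp_add, add_neg_cancel, Real.exp_zero]
  have hmθ : m * θ ^ 2 ≤ 0.00001 := by
    have := mul_le_mul hM hθ6 hθ0.le (by norm_num)
    calc m * θ ^ 2 = m * θ * θ := by ring
      _ ≤ _ := this
      _ ≤ _ := by norm_num
  have key : 0.2632 * (d * Real.exp (m * θ) + (q - d)) ≤ (1 - m * θ ^ 2) * q := by
    have h1 := mul_le_mul_of_nonneg_left he hd0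
    have h2 := mul_le_mul_of_nonneg_right hmθ hq0.le
    linarith
  rw [h1θ]
  calc 0.2632 * (q - (q - d) * (1 - Real.exp (-(m * θ))))
      = 0.2632 * (d * (Real.exp (m * θ) * Real.exp (-(m * θ))) +
          (q - d) * Real.exp (-(m * θ))) := by rw [hee]; ring
    _ = 0.2632 * (d * Real.exp (m * θ) + (q - d)) * Real.exp (-(m * θ)) := by ring
    _ ≤ (1 - m * θ ^ 2) * q * Real.exp (-(m * θ)) :=
      mul_le_mul_of_nonneg_right key (Real.exp_pos _).le
    _ = _ := by ring

/-- Belief propagation contracts the squared Euclidean distance when the two families agree on the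
pinned indices and, on each free index `i`, vanish on a common set `A i` and have the upper and
lower bounds of free vertices of the tree off `A i`. -/
theorem beliefPropagation_contraction {k : ι → Option κ} {x x' : ι → κ → ℝ} {m : ℝ}
    (A : ι → Finset κ)
    (hq : 1.59 * (Fintype.card ι : ℝ) + 10 ^ 6 ≤ Fintype.card κ) (hm0 : 0 ≤ m)
    (hk : ∀ i a, k i = some a → x i = Pi.single a 1)
    (hk' : ∀ i a, k i = some a → x' i = Pi.single a 1)
    (hx : ∀ i, x i ∈ stdSimplex ℝ κ) (hx' : ∀ i, x' i ∈ stdSimplex ℝ κ)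
    (hxθ : ∀ i ∈ freeIndices k, ∀ c, x i c ≤ 1 / ((Fintype.card κ : ℝ) - Fintype.card ι))
    (hxθ' : ∀ i ∈ freeIndices k, ∀ c, x' i c ≤ 1 / ((Fintype.card κ : ℝ) - Fintype.card ι))
    (hA : ∀ i ∈ freeIndices k, ∀ c ∈ A i, x i c = 0 ∧ x' i c = 0)
    (hL : ∀ i ∈ freeIndices k, ∀ c ∉ A i, 0.2632 / (Fintype.card κ : ℝ) ≤ x i c ∧
      0.2632 / (Fintype.card κ : ℝ) ≤ x' i c)
    (hm : ∀ i, ∑ c, (x i c - x' i c) ^ 2 ≤ m) :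
    ∑ c, (beliefPropagation x c - beliefPropagation x' c) ^ 2 ≤ 0.9999 * m := by
  have hG' := card_availableColors_ge k
  set q := (Fintype.card κ : ℝ) with hqdef
  set d := (Fintype.card ι : ℝ) with hddef
  have hd0 : 0 ≤ d := Nat.cast_nonneg _
  have hqd : 0 < q - d := by linarith
  set θ : ℝ := 1 / (q - d) with hθ
  have hθ0 : 0 < θ := one_div_pos.2 hqd
  have hθ6 : θ ≤ 1 / 10 ^ 6 := one_div_le_one_div_of_le (by norm_num) (by linarith)
  have hθ1 : θ < 1 := hθ6.trans_lt (by norm_num)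
  set G := availableColors k with hG
  set I := freeIndices k with hI
  have hGne : G.Nonempty := by
    rw [← Finset.card_pos, ← Nat.cast_pos (α := ℝ)]
    have : (0 : ℝ) ≤ #I := Nat.cast_nonneg _
    linarith
  have hsum : ∀ z : κ → ℝ, z ∈ stdSimplex ℝ κ → ∑ c ∈ G, z c ≤ 1 := fun z hz =>
    hz.2 ▸ Finset.sum_le_univ_sum_of_nonneg hz.1
  have hcontr := softmax_logWeight_contraction hGne I A (x := x') (x' := x) (θ := θ)
    (K := 0.9998) hθ1 hm0
    (fun i _ => (Finset.sum_le_univ_sum_of_nonneg fun c => sq_nonneg _).trans (hm i))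
    (fun i hi c _ => hxθ' i hi c) (fun i hi c _ => hxθ i hi c)
    (fun i hi c hc => (hA i hi c hc).2.trans (hA i hi c hc).1.symm) (by
      intro s hs c hc
      have hs0 := hs.1.le
      have hs1 := sub_nonneg.2 hs.2.le
      have hconv : ∀ i c, x' i c + s * (x i c - x' i c) = (1 - s) * x' i c + s * x i c :=
        fun i c => by ring
      have hmem : ∀ i, (fun c => x' i c + s * (x i c - x' i c)) ∈ stdSimplex ℝ κ := by
        intro i
        have := convex_stdSimplex ℝ κ (hx' i) (hx i) hs1 hs0 (sub_add_cancel _ _)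
        convert this using 1
        funext c
        simp [hconv]
      refine le_trans (mul_le_mul_of_nonneg_left (softmax_logWeight_le hGne I A
        (L := 0.2632 / q) hθ1
        (fun i _ c _ => (hmem i).1 c) (fun i hi c _ => ?_) (fun i _ => hsum _ (hmem i))
        (fun i hi c _ hcA => ?_) hc) (by positivity)) ?_
      · rw [hconv]
        nlinarith [hxθ i hi c, hxθ' i hi c]
      · rw [hconv]
        nlinarith [(hL i hi c hcA).1, (hL i hi c hcA).2]
      · refine contraction_factor_le hd0 hq (Nat.cast_nonneg _) ?_ hG' ?_ hθ0.le hθ6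
        · rw [hddef]; exact_mod_cast Finset.card_le_univ _
        · exact_mod_cast Finset.card_filter_le _ _)
  have heq : ∑ c, (beliefPropagation x c - beliefPropagation x' c) ^ 2 =
      ∑ c ∈ G, (softmax G (logWeight I x) c - softmax G (logWeight I x') c) ^ 2 := by
    rw [← Finset.sum_subset (Finset.subset_univ G) fun c _ hc => by
      rw [beliefPropagation_eq_zero hk hc, beliefPropagation_eq_zero hk' hc]; ring]
    refine Finset.sum_congr rfl fun c hc => ?_
    rw [beliefPropagation_eq_softmax hk (fun i hi c => (hxθ i hi c).trans_lt hθ1) hc,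
      beliefPropagation_eq_softmax hk' (fun i hi c => (hxθ' i hi c).trans_lt hθ1) hc]
  rw [heq]
  refine hcontr.trans (mul_le_mul_of_nonneg_right ?_ hm0)
  have h1 : 0.9998 / (1 - θ) ≤ 0.99985 := by
    rw [div_le_iff₀ (by linarith)]; linarith
  calc (0.9998 / (1 - θ)) ^ 2 ≤ 0.99985 ^ 2 := by
        have : 0 ≤ 0.9998 / (1 - θ) := div_nonneg (by norm_num) (by linarith)
        gcongr
    _ ≤ 0.9999 := by norm_num

end BeliefPropagation

/-! ### Pinned colorings of the tree -/

/-- The vertex `w` of the subtree at the `i`-th child of the root, that subtree being identified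
with the tree of height `h`. -/
def consVertex {d h : ℕ} (i : Fin d) (w : TreeVertex d h) : TreeVertex d (h + 1) :=
  ⟨i :: w.1, Nat.succ_le_succ w.2⟩

/-- The coloring with root color `c` and the colorings `τ i` on the subtrees at the children. -/
def glueColoring {d h q : ℕ} (c : Fin q) (τ : Fin d → TreeVertex d h → Fin q) :
    TreeVertex d (h + 1) → Fin q
  | ⟨[], _⟩ => c
  | ⟨i :: w, hw⟩ => τ i ⟨w, Nat.le_of_succ_le_succ hw⟩

theorem treeVertex_cases {d h : ℕ} {P : TreeVertex d (h + 1) → Prop}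
    (root : P (treeRoot d (h + 1))) (cons : ∀ i w, P (consVertex i w)) (v) : P v := by
  obtain ⟨_ | ⟨i, w⟩, hw⟩ := v
  · exact root
  · exact cons i ⟨w, Nat.le_of_succ_le_succ hw⟩

theorem daryTree_adj_root_cons {d h : ℕ} (i : Fin d) (w : TreeVertex d h) :
    (daryTree d (h + 1)).Adj (treeRoot d (h + 1)) (consVertex i w) ↔ w = treeRoot d h := by
  obtain ⟨w, hw⟩ := w
  simp [daryTree, SimpleGraph.fromRel_adj, treeRoot, consVertex]

theorem daryTree_adj_cons_cons {d h : ℕ} (i j : Fin d) (v w : TreeVertex d h) :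
    (daryTree d (h + 1)).Adj (consVertex i v) (consVertex j w) ↔
      i = j ∧ (daryTree d h).Adj v w := by
  obtain ⟨v, hv⟩ := v
  obtain ⟨w, hw⟩ := w
  simp only [daryTree, SimpleGraph.fromRel_adj, consVertex, ne_eq, Subtype.mk.injEq,
    List.cons.injEq, List.cons_append]
  constructor
  · rintro ⟨h1, ⟨l, rfl, h2⟩ | ⟨l, rfl, h2⟩⟩
    · exact ⟨rfl, by simpa using h1, Or.inl ⟨l, h2⟩⟩
    · exact ⟨rfl, by simpa using h1, Or.inr ⟨l, h2⟩⟩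
  · rintro ⟨rfl, h1, ⟨l, h2⟩ | ⟨l, h2⟩⟩
    · exact ⟨by simpa using h1, Or.inl ⟨l, rfl, h2⟩⟩
    · exact ⟨by simpa using h1, Or.inr ⟨l, rfl, h2⟩⟩

/-- The proper colorings that extend the partial coloring `f`, where `f u = none` means that `u` is
not assigned a color. -/
def pinnedColorings {d h q : ℕ} (f : TreeVertex d h → Option (Fin q)) :
    Set (TreeVertex d h → Fin q) :=
  {σ | σ ∈ properColorings (daryTree d h) q ∧ ∀ u c, f u = some c → σ u = c}

theorem mem_pinnedColorings_succ {d h q : ℕ} {f : TreeVertex d (h + 1) → Option (Fin q)}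
    {σ : TreeVertex d (h + 1) → Fin q} :
    σ ∈ pinnedColorings f ↔ (∀ c, f (treeRoot d (h + 1)) = some c → σ (treeRoot d (h + 1)) = c) ∧
      ∀ i, (fun w => σ (consVertex i w)) ∈ pinnedColorings (fun w => f (consVertex i w)) ∧
        σ (consVertex i (treeRoot d h)) ≠ σ (treeRoot d (h + 1)) := by
  constructor
  · rintro ⟨h1, h2⟩
    refine ⟨h2 _, fun i => ⟨⟨fun u v huv => h1 _ _ ?_, fun u => h2 _⟩, ?_⟩⟩
    · exact (daryTree_adj_cons_cons i i u v).2 ⟨rfl, huv⟩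
    · exact (h1 _ _ ((daryTree_adj_root_cons i _).2 rfl)).symm
  · rintro ⟨h1, h2⟩
    refine ⟨fun u v h => ?_, fun u => ?_⟩
    · induction u using treeVertex_cases with
      | root =>
        induction v using treeVertex_cases with
        | root => exact absurd h (SimpleGraph.irrefl _)
        | cons j v =>
          rw [daryTree_adj_root_cons] at h
          exact h ▸ (h2 j).2.symm
      | cons i u =>
        induction v using treeVertex_cases with
        | root =>
          rw [SimpleGraph.adj_comm, daryTree_adj_root_cons] at h
          exact h ▸ (h2 i).2
        | cons j v =>
          rw [daryTree_adj_cons_cons] at h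
          obtain ⟨rfl, h⟩ := h
          exact (h2 i).1.1 _ _ h
    · induction u using treeVertex_cases with
      | root => exact h1
      | cons i w => exact (h2 i).1.2 w

theorem pinnedColorings_cons_nonempty {d h q : ℕ} {f : TreeVertex d (h + 1) → Option (Fin q)}
    (hf : (pinnedColorings f).Nonempty) (i : Fin d) :
    (pinnedColorings fun w => f (consVertex i w)).Nonempty :=
  let ⟨_, hσ⟩ := hf
  ⟨_, ((mem_pinnedColorings_succ.1 hσ).2 i).1⟩

/-- The number of proper colorings that extend `f` and give the root the color `c`. -/
def rootCount {d h q : ℕ} (f : TreeVertex d h → Option (Fin q)) (c : Fin q) : ℕ :=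
  (pinnedColorings f ∩ {σ | σ (treeRoot d h) = c}).ncard

theorem ncard_root_mem {d h q : ℕ} (f : TreeVertex d h → Option (Fin q)) (s : Finset (Fin q)) :
    (pinnedColorings f ∩ {σ | σ (treeRoot d h) ∈ s}).ncard = ∑ c ∈ s, rootCount f c := by
  classical
  induction s using Finset.induction_on with
  | empty => simp
  | insert a s ha ih =>
    rw [Finset.sum_insert ha, ← ih, rootCount, ← Set.ncard_union_eq _ (Set.toFinite _)
      (Set.toFinite _)]
    · congr 1
      ext σ
      simp only [Set.mem_inter_iff, Set.mem_ofPred_eq, Set.mem_union, Finset.mem_insert]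
      tauto
    · rw [Set.disjoint_left]
      rintro σ ⟨_, h1⟩ ⟨_, h2⟩
      exact ha ((show σ _ = a from h1) ▸ h2)

theorem sum_rootCount {d h q : ℕ} (f : TreeVertex d h → Option (Fin q)) :
    ∑ c, rootCount f c = (pinnedColorings f).ncard := by
  rw [← ncard_root_mem]
  simp

/-- Given the color `c` of a free root, the subtrees at its children are colored independently,
each with a root color other than `c`. -/
theorem rootCount_succ {d h q : ℕ} {f : TreeVertex d (h + 1) → Option (Fin q)}
    (hf : f (treeRoot d (h + 1)) = none) (c : Fin q) :
    rootCount f c = ∏ i, ∑ c' ∈ univ.erase c, rootCount (fun w => f (consVertex i w)) c' := by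
  simp only [← ncard_root_mem]
  simp only [rootCount, ← Nat.card_coe_set_eq]
  rw [← Nat.card_pi]
  refine Nat.card_congr
    { toFun := fun σ i => ⟨fun w => σ.1 (consVertex i w), ?_⟩
      invFun := fun τ => ⟨glueColoring c fun i => (τ i).1, ?_⟩
      left_inv := ?_
      right_inv := fun τ => rfl }
  · obtain ⟨σ, hσ, hc⟩ := σ
    obtain ⟨h1, h2⟩ := (mem_pinnedColorings_succ.1 hσ).2 i
    rw [show σ (treeRoot d (h + 1)) = c from hc] at h2
    exact ⟨h1, show σ (consVertex i (treeRoot d h)) ∈ univ.erase c from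
      Finset.mem_erase.2 ⟨h2, Finset.mem_univ _⟩⟩
  · refine ⟨mem_pinnedColorings_succ.2 ⟨by simp [hf], fun i => ⟨(τ i).2.1, ?_⟩⟩, rfl⟩
    have h1 : (τ i).1 (treeRoot d h) ∈ univ.erase c := (τ i).2.2
    exact (Finset.mem_erase.1 h1).1
  · rintro ⟨σ, hσ, hc⟩
    refine Subtype.ext (funext fun v => ?_)
    exact treeVertex_cases (P := fun v => glueColoring c (fun i w => σ (consVertex i w)) v = σ v)
      (Eq.symm hc) (fun i w => rfl) v

theorem rootCount_zero {d q : ℕ} {f : TreeVertex d 0 → Option (Fin q)}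
    (hf : f (treeRoot d 0) = none) (c : Fin q) : rootCount f c = 1 := by
  have hsub : ∀ u : TreeVertex d 0, u = treeRoot d 0 := fun u =>
    Subtype.ext (List.length_eq_zero_iff.1 (Nat.le_zero.1 u.2))
  rw [rootCount, Set.ncard_eq_one]
  refine ⟨fun _ => c, Set.eq_singleton_iff_unique_mem.2 ⟨⟨⟨?_, ?_⟩, rfl⟩, ?_⟩⟩
  · intro u v huv
    rw [hsub u, hsub v] at huv
    exact absurd huv (SimpleGraph.irrefl _)
  · intro u a hu
    rw [hsub u, hf] at hu
    exact absurd hu (Option.some_ne_none a).symm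
  · rintro σ ⟨_, hσ⟩
    funext u
    rw [hsub u]
    exact hσ

/-- The marginal at the root of a uniform proper coloring that extends `f`. -/
def rootMarginal {d h q : ℕ} (f : TreeVertex d h → Option (Fin q)) (c : Fin q) : ℝ :=
  rootCount f c / ∑ c', (rootCount f c' : ℝ)

theorem sum_rootCount_pos {d h q : ℕ} {f : TreeVertex d h → Option (Fin q)}
    (hf : (pinnedColorings f).Nonempty) : 0 < ∑ c, (rootCount f c : ℝ) := by
  have := sum_rootCount f
  have h2 := (Set.ncard_pos (Set.toFinite _)).2 hf
  rw [← this] at h2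
  exact_mod_cast h2

theorem rootMarginal_mem_stdSimplex {d h q : ℕ} {f : TreeVertex d h → Option (Fin q)}
    (hf : (pinnedColorings f).Nonempty) : rootMarginal f ∈ stdSimplex ℝ (Fin q) := by
  have h := sum_rootCount_pos hf
  refine ⟨fun c => div_nonneg (Nat.cast_nonneg _) h.le, ?_⟩
  simp only [rootMarginal]
  rw [← Finset.sum_div, div_self h.ne']

theorem rootMarginal_of_pinned {d h q : ℕ} {f : TreeVertex d h → Option (Fin q)}
    (hf : (pinnedColorings f).Nonempty) {a : Fin q} (ha : f (treeRoot d h) = some a) :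
    rootMarginal f = Pi.single a 1 := by
  have h0 : ∀ c, c ≠ a → rootMarginal f c = 0 := by
    intro c hc
    have : rootCount f c = 0 := by
      rw [rootCount, Set.ncard_eq_zero]
      refine Set.eq_empty_of_forall_notMem fun σ hσ => hc ?_
      rw [← hσ.1.2 _ _ ha]
      exact hσ.2.symm
    rw [rootMarginal, this, Nat.cast_zero, zero_div]
  have h1 := (rootMarginal_mem_stdSimplex hf).2
  rw [Finset.sum_eq_single a (fun c _ hc => h0 c hc) (by simp)] at h1
  funext c
  by_cases hc : c = a
  · subst hc; simp [h1]
  · simp [hc, h0 c hc]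

theorem rootMarginal_zero {d q : ℕ} {f : TreeVertex d 0 → Option (Fin q)}
    (hf : f (treeRoot d 0) = none) (c : Fin q) : rootMarginal f c = 1 / q := by
  simp [rootMarginal, rootCount_zero hf]

theorem rootMarginal_succ {d h q : ℕ} {f : TreeVertex d (h + 1) → Option (Fin q)}
    (hne : (pinnedColorings f).Nonempty) (hf : f (treeRoot d (h + 1)) = none) :
    rootMarginal f = beliefPropagation fun i => rootMarginal fun w => f (consVertex i w) := by
  set S : Fin d → ℝ := fun i => ∑ c, (rootCount (fun w => f (consVertex i w)) c : ℝ) with hS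
  have hS0 : ∀ i, S i ≠ 0 := fun i =>
    (sum_rootCount_pos (pinnedColorings_cons_nonempty hne i)).ne'
  have h1 : ∀ c, (rootCount f c : ℝ) =
      (∏ i, S i) * ∏ i, (1 - rootMarginal (fun w => f (consVertex i w)) c) := by
    intro c
    rw [rootCount_succ hf, ← Finset.prod_mul_distrib]
    push_cast
    refine Finset.prod_congr rfl fun i _ => ?_
    rw [rootMarginal, mul_sub, mul_one, mul_div_cancel₀ _ (hS0 i)]
    simp only [hS]
    rw [← Finset.sum_erase_add _ _ (Finset.mem_univ c), add_sub_cancel_right]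
  funext c
  simp only [rootMarginal, beliefPropagation, h1]
  rw [← Finset.mul_sum, mul_div_mul_left _ _ (Finset.prod_ne_zero_iff.2 fun i _ => hS0 i)]

/-- Whatever colors the `d` children take, at least `q - d` colors remain for a free root. -/
theorem rootMarginal_le {d h q : ℕ} {f : TreeVertex d h → Option (Fin q)} (hdq : d < q)
    (hne : (pinnedColorings f).Nonempty) (hf : f (treeRoot d h) = none) (c : Fin q) :
    rootMarginal f c ≤ 1 / ((q : ℝ) - d) := by
  cases h with
  | zero =>
    rw [rootMarginal_zero hf]
    refine one_div_le_one_div_of_le (sub_pos.2 (by exact_mod_cast hdq)) ?_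
    linarith [Nat.cast_nonneg (α := ℝ) d]
  | succ h =>
    rw [rootMarginal_succ hne hf]
    have := beliefPropagation_le (y := fun i => rootMarginal fun w => f (consVertex i w))
      (fun i => rootMarginal_mem_stdSimplex (pinnedColorings_cons_nonempty hne i))
      (by simpa using hdq) c
    simpa using this

/-- The assignment `η` on `Λ` as a partial coloring of all vertices. -/
def pins {d h q : ℕ} {Λ : Set (TreeVertex d h)} (η : Λ → Fin q) (u : TreeVertex d h) :
    Option (Fin q) :=
  open Classical in if hu : u ∈ Λ then some (η ⟨u, hu⟩) else none

theorem pins_eq_some {d h q : ℕ} {Λ : Set (TreeVertex d h)} {η : Λ → Fin q} {u : TreeVertex d h}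
    {c : Fin q} : pins η u = some c ↔ ∃ hu : u ∈ Λ, η ⟨u, hu⟩ = c := by
  unfold pins
  split_ifs with hu <;> simp [hu]

theorem pinnedColorings_pins {d h q : ℕ} {Λ : Set (TreeVertex d h)} (η : Λ → Fin q) :
    pinnedColorings (pins η) = properColorings (daryTree d h) q ∩ agreeEvent η := by
  ext σ
  refine and_congr_right fun _ => ?_
  simp only [pins_eq_some, agreeEvent, Set.mem_ofPred_eq]
  constructor
  · exact fun h => funext fun u => h u.1 _ ⟨u.2, rfl⟩
  · rintro rfl u _ ⟨hu, rfl⟩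
    rfl

theorem marginal_eq_rootMarginal {d h q : ℕ} {Λ : Set (TreeVertex d h)} (η : Λ → Fin q)
    (c : Fin q) : marginal (daryTree d h) (treeRoot d h) η c = rootMarginal (pins η) c := by
  rw [marginal_apply, rootMarginal, rootCount, ← Nat.cast_sum, sum_rootCount,
    pinnedColorings_pins]

/-- The tree of height `n` as the set of descendants of the `i`-th child of the root. -/
def descendantsEquiv {d n : ℕ} (hh : 1 ≤ n + 1) (i : Fin d) :
    TreeVertex d n ≃ descendants (rootChild hh i) where
  toFun w := ⟨consVertex i w, by simp [descendants, rootChild, consVertex]⟩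
  invFun v := ⟨v.1.1.tail, by have := v.1.2; simp only [List.length_tail]; omega⟩
  left_inv w := rfl
  right_inv := by
    rintro ⟨⟨_ | ⟨j, w⟩, hw⟩, hv⟩
    · simp [descendants, rootChild] at hv
    · have : i = j := by simpa [descendants, rootChild] using hv
      subst this
      rfl

theorem comp_descendantsEquiv_mem {d n q : ℕ} (hh : 1 ≤ n + 1) {Λ : Set (TreeVertex d (n + 1))}
    (η : Λ → Fin q) (i : Fin d) (σ : descendants (rootChild hh i) → Fin q) :
    σ ∈ properColorings ((daryTree d (n + 1)).induce (descendants (rootChild hh i))) q ∩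
        agreeEvent (restrictAssignment (descendants (rootChild hh i)) η) ↔
      (fun w => σ (descendantsEquiv hh i w)) ∈
        pinnedColorings fun w => pins η (consVertex i w) := by
  refine and_congr ?_ ?_
  · simp only [properColorings, Set.mem_ofPred_eq]
    rw [← (descendantsEquiv hh i).forall_congr_right]
    refine forall_congr' fun u => ?_
    rw [← (descendantsEquiv hh i).forall_congr_right]
    refine forall_congr' fun v => ?_
    rw [SimpleGraph.comap_adj]
    exact imp_congr_left ((daryTree_adj_cons_cons i i u v).trans (and_iff_right rfl))
  · simp only [pins_eq_some, agreeEvent, Set.mem_ofPred_eq]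
    constructor
    · rintro h u _ ⟨hu, rfl⟩
      exact congrFun h ⟨descendantsEquiv hh i u, hu⟩
    · rintro h
      funext ⟨v, hv⟩
      obtain ⟨u, rfl⟩ := (descendantsEquiv hh i).surjective v
      exact h u _ ⟨hv, rfl⟩

theorem childMarginal_eq_rootMarginal {d n q : ℕ} (hh : 1 ≤ n + 1)
    {Λ : Set (TreeVertex d (n + 1))} (η : Λ → Fin q) (i : Fin d) (c : Fin q) :
    childMarginal hh η i c = rootMarginal (fun w => pins η (consVertex i w)) c := by
  rw [childMarginal, marginal_apply, rootMarginal, rootCount, ← Nat.cast_sum, sum_rootCount]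
  congr 2
  · exact Nat.card_congr (((descendantsEquiv hh i).symm.arrowCongr (Equiv.refl _)).subtypeEquiv
      fun σ => and_congr (comp_descendantsEquiv_mem hh η i σ) Iff.rfl)
  · exact Nat.card_congr (((descendantsEquiv hh i).symm.arrowCongr (Equiv.refl _)).subtypeEquiv
      fun σ => comp_descendantsEquiv_mem hh η i σ)

theorem edist_treeRoot_le {d h : ℕ} (u : TreeVertex d h) :
    (daryTree d h).edist (treeRoot d h) u ≤ u.1.length := by
  obtain ⟨w, hw⟩ := u
  induction w using List.reverseRecOn with
  | nil => simp [treeRoot]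
  | append_singleton w i ih =>
    have hw' : w.length ≤ h := by simp at hw; omega
    have hadj : (daryTree d h).Adj ⟨w, hw'⟩ ⟨w ++ [i], hw⟩ := by
      simp [daryTree, SimpleGraph.fromRel_adj]
    refine (SimpleGraph.edist_triangle (v := (⟨w, hw'⟩ : TreeVertex d h))).trans ?_
    rw [SimpleGraph.edist_eq_one_iff_adj.2 hadj]
    simpa using add_le_add (ih hw') (le_refl 1)

theorem pins_eq_of_length_le {d h q : ℕ} {Λ : Set (TreeVertex d h)} {η η' : Λ → Fin q}
    (hdist : 3 ≤ distToSet (daryTree d h) (treeRoot d h) (disagreement η η'))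
    {u : TreeVertex d h} (hu : u.1.length ≤ 2) : pins η u = pins η' u := by
  unfold pins
  split_ifs with hΛ
  · by_contra hne
    have h1 : u ∈ disagreement η η' := ⟨hΛ, fun h => hne (by rw [h])⟩
    have h2 : (3 : ℕ∞) ≤ u.1.length :=
      (hdist.trans (iInf₂_le u h1)).trans (edist_treeRoot_le u)
    have h3 : 3 ≤ u.1.length := by exact_mod_cast h2
    omega
  · rfl

/-! ### Contraction of the marginals at the root -/

/-- For the marginals at a free vertex under two partial colorings that agree at its children, `A`
is the set of the colors pinned on these children. -/
theorem exists_support_rootMarginal {d h q : ℕ} (hq : 1.59 * (d : ℝ) + 10 ^ 6 ≤ q)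
    {g g' : TreeVertex d h → Option (Fin q)} (hg : (pinnedColorings g).Nonempty)
    (hg' : (pinnedColorings g').Nonempty) (hgg : ∀ u : TreeVertex d h, u.1.length ≤ 1 → g u = g' u)
    (hroot : g (treeRoot d h) = none) :
    ∃ A : Finset (Fin q), (∀ c ∈ A, rootMarginal g c = 0 ∧ rootMarginal g' c = 0) ∧
      ∀ c ∉ A, 0.2632 / (q : ℝ) ≤ rootMarginal g c ∧ 0.2632 / (q : ℝ) ≤ rootMarginal g' c := by
  have hroot' : g' (treeRoot d h) = none := (hgg _ (Nat.zero_le _)).symm.trans hroot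
  cases h with
  | zero =>
    refine ⟨∅, by simp, fun c _ => ?_⟩
    rw [rootMarginal_zero hroot, rootMarginal_zero hroot', and_self]
    gcongr
    norm_num
  | succ h =>
    have hdq : d < q := by
      have : (d : ℝ) < q := by linarith [Nat.cast_nonneg (α := ℝ) d]
      exact_mod_cast this
    set k : Fin d → Option (Fin q) := fun j => g (consVertex j (treeRoot d h)) with hk
    have key : ∀ f : TreeVertex d (h + 1) → Option (Fin q), (pinnedColorings f).Nonempty →
        (∀ j, f (consVertex j (treeRoot d h)) = k j) → f (treeRoot d (h + 1)) = none →
        (∀ c ∉ availableColors k, rootMarginal f c = 0) ∧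
          ∀ c ∈ availableColors k, 0.2632 / (q : ℝ) ≤ rootMarginal f c := by
      intro f hne hfk hf
      have hne' := pinnedColorings_cons_nonempty hne
      have hpin : ∀ j a, k j = some a →
          rootMarginal (fun w => f (consVertex j w)) = Pi.single a 1 := fun j a hja =>
        rootMarginal_of_pinned (hne' j) ((hfk j).trans hja)
      rw [rootMarginal_succ hne hf]
      refine ⟨fun c hc => beliefPropagation_eq_zero hpin hc, fun c hc => ?_⟩
      have := beliefPropagation_ge (k := k)
        (y := fun j => rootMarginal fun w => f (consVertex j w)) (by simpa using hq) hpin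
        (fun j => rootMarginal_mem_stdSimplex (hne' j)) (fun j hj c => by
          simpa using rootMarginal_le hdq (hne' j) ((hfk j).trans (mem_freeIndices.1 hj)) c) hc
      simpa using this
    obtain ⟨h1, h2⟩ := key g hg (fun j => rfl) hroot
    obtain ⟨h3, h4⟩ := key g' hg' (fun j => (hgg _ le_rfl).symm) hroot'
    refine ⟨(availableColors k)ᶜ, fun c hc => ?_, fun c hc => ?_⟩
    · rw [Finset.mem_compl] at hc
      exact ⟨h1 c hc, h3 c hc⟩
    · rw [Finset.mem_compl, not_not] at hc
      exact ⟨h2 c hc, h4 c hc⟩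

theorem rootMarginal_contraction {d h q : ℕ} (hq : 1.59 * (d : ℝ) + 10 ^ 6 ≤ q)
    {f f' : TreeVertex d (h + 1) → Option (Fin q)} (hf : (pinnedColorings f).Nonempty)
    (hf' : (pinnedColorings f').Nonempty)
    (hff : ∀ u : TreeVertex d (h + 1), u.1.length ≤ 2 → f u = f' u) {m : ℝ} (hm0 : 0 ≤ m)
    (hm : ∀ i, ∑ c, (rootMarginal (fun w => f (consVertex i w)) c -
      rootMarginal (fun w => f' (consVertex i w)) c) ^ 2 ≤ m) :
    ∑ c, (rootMarginal f c - rootMarginal f' c) ^ 2 ≤ 0.9999 * m := by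
  have hroot := hff (treeRoot d (h + 1)) (Nat.zero_le _)
  cases hr : f (treeRoot d (h + 1)) with
  | some a =>
    rw [rootMarginal_of_pinned hf hr, rootMarginal_of_pinned hf' (hroot.symm.trans hr)]
    simp only [sub_self, ne_eq, OfNat.ofNat_ne_zero, not_false_eq_true, zero_pow,
      Finset.sum_const_zero]
    positivity
  | none =>
    have hdq : d < q := by
      have : (d : ℝ) < q := by linarith [Nat.cast_nonneg (α := ℝ) d]
      exact_mod_cast this
    have hne := pinnedColorings_cons_nonempty hf
    have hne' := pinnedColorings_cons_nonempty hf'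
    set k : Fin d → Option (Fin q) := fun i => f (consVertex i (treeRoot d h)) with hk
    have hk' : ∀ i, f' (consVertex i (treeRoot d h)) = k i := fun i =>
      (hff (consVertex i (treeRoot d h)) (by simp [consVertex, treeRoot])).symm
    have hA : ∀ i, ∃ A : Finset (Fin q), i ∈ freeIndices k →
        (∀ c ∈ A, rootMarginal (fun w => f (consVertex i w)) c = 0 ∧
          rootMarginal (fun w => f' (consVertex i w)) c = 0) ∧
        ∀ c ∉ A, 0.2632 / (q : ℝ) ≤ rootMarginal (fun w => f (consVertex i w)) c ∧
          0.2632 / (q : ℝ) ≤ rootMarginal (fun w => f' (consVertex i w)) c := by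
      intro i
      by_cases hi : i ∈ freeIndices k
      · obtain ⟨A, hA⟩ := exists_support_rootMarginal hq (hne i) (hne' i)
          (fun u hu => hff _ (Nat.succ_le_succ hu)) ((mem_freeIndices (k := k)).1 hi)
        exact ⟨A, fun _ => hA⟩
      · exact ⟨∅, fun h => absurd h hi⟩
    choose A hA using hA
    rw [rootMarginal_succ hf hr, rootMarginal_succ hf' (hroot.symm.trans hr)]
    refine beliefPropagation_contraction (k := k) A (by simpa using hq) hm0
      (fun i a ha => rootMarginal_of_pinned (hne i) ha)
      (fun i a ha => rootMarginal_of_pinned (hne' i) ((hk' i).trans ha))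
      (fun i => rootMarginal_mem_stdSimplex (hne i))
      (fun i => rootMarginal_mem_stdSimplex (hne' i))
      (fun i hi c => ?_) (fun i hi c => ?_) (fun i hi => (hA i hi).1)
      (fun i hi => by simpa using (hA i hi).2) hm
    · simpa using rootMarginal_le hdq (hne i) ((mem_freeIndices (k := k)).1 hi) c
    · simpa using rootMarginal_le hdq (hne' i) ((hk' i).trans ((mem_freeIndices (k := k)).1 hi)) c

end

end

theorem theorem3 :
    ∃ β : ℝ, 0 < β ∧ ∃ U : ℝ, U ∈ Set.Ioo (0 : ℝ) 1 ∧
      ∀ q d : ℕ, 0 < q → 0 < d → 1.59 * (d : ℝ) + β ≤ (q : ℝ) →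
        ∀ (h : ℕ) (hh : 1 ≤ h) (Λ : Set (TreeVertex d h)) (η η' : Λ → Fin q),
          Extendible (daryTree d h) η → Extendible (daryTree d h) η' →
          3 ≤ distToSet (daryTree d h) (treeRoot d h) (disagreement η η') →
          ‖marginal (daryTree d h) (treeRoot d h) η
              - marginal (daryTree d h) (treeRoot d h) η'‖ ^ 2 ≤
            U * ⨆ i : Fin d, ‖childMarginal hh η i - childMarginal hh η' i‖ ^ 2 := by
  refine ⟨10 ^ 6, by norm_num, 0.9999, by norm_num, ?_⟩
  intro q d _ _ hq h hh Λ η η' hη hη' hdist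
  obtain ⟨h, rfl⟩ : ∃ n, h = n + 1 := ⟨h - 1, by omega⟩
  have hne : ∀ ζ : Λ → Fin q, Extendible (daryTree d (h + 1)) ζ →
      (pinnedColorings (pins ζ)).Nonempty := by
    rintro ζ ⟨σ, h1, h2⟩
    exact ⟨σ, by rw [pinnedColorings_pins]; exact ⟨h1, h2⟩⟩
  simp only [EuclideanSpace.norm_sq_eq, PiLp.sub_apply, Real.norm_eq_abs, sq_abs,
    marginal_eq_rootMarginal, childMarginal_eq_rootMarginal]
  refine rootMarginal_contraction hq (hne η hη) (hne η' hη')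
    (fun u hu => pins_eq_of_length_le hdist hu)
    (Real.iSup_nonneg fun i => Finset.sum_nonneg fun _ _ => sq_nonneg _) fun i => ?_
  exact le_ciSup (f := fun i => ∑ c, (rootMarginal (fun w => pins η (consVertex i w)) c -
    rootMarginal (fun w => pins η' (consVertex i w)) c) ^ 2) (Set.finite_range _).bddAbove i
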